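/- Let $A$ be an integer $d\times n$ matrix with columns $a_1,\dots,a_n\in\mathbb Z^d$ and let $U\in\mathbb N^n$ (zero entries allowed). Put $\mathbb L=A\,\mathbb Z^n$, and let $Z_A(U)=\sum_{v=1}^n U_v\cdot[0,a_v]\subset\mathbb R^d$ (a Minkowski sum of segments). For $b\in\mathbb Z^d$ let $$\phi_A(b,U)=\sum_{x\in\mathbb Z^n,\ 0\le x_v\le U_v,\ Ax=b}\ \prod_{v=1}^n\binom{U_v}{x_v},\qquad M_A(U)=\{b\in Z_A(U)\cap\mathbb L:\ \phi_A(b,U)\ne 0\}.$$ A set $S\subseteq\{1,\dots,n\}$ of column labels is called independent if the columns $a_v$, $v\in S$, are linearly independent over $\mathbb R$ (equal columns with different labels are dependent), and then $\mathrm{index}(S)=[\mathbb RS\cap\mathbb L:\mathbb ZS]$, where $\mathbb RS$ and $\mathbb ZS$ are the real span of, and the group generated by, the columns $a_v$, $v\in S$. The matrix $A$ is unimodular if $\mathrm{index}(S)=1$ for every independent $S$. **Theorem.** The set $M_A(U)$ is finite, and $$\sum_{S\ \text{indep.}}\ \prod_{v\in S}U_v\ \le\ \#M_A(U)\ \le\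 \sum_{S\ \text{indep.}}\mathrm{index}(S)\cdot\prod_{v\in S}U_v ,$$ where both sums run over all independent sets $S$ of column labels, including $S=\emptyset$. If $A$ is unimodular, the two bounds coincide. In particular, this holds for the matrix $A$ of an independence model. Let $k\ge1$, $s_1,\dots,s_k\ge1$ and $t_1,\dots,t_k\ge0$ be integers. The columns of $A$ are labelled by the states $v=(v^{(i)}_j)_{1\le i\le k,\,1\le j\le s_i}$ with $v^{(i)}_j\in\{0,\dots,t_i\}$, and the rows by the parameters $\theta^{(i)}_j$ with $1\le i\le k$, $0\le j\le t_i$; the column $a_v$ is the exponent vector of the monomial $\theta^{a_v}=\prod_{i=1}^k\prod_{j=1}^{s_i}\theta^{(i)}_{v^{(i)}_j}$. For such $A$ and any data vector $U$ (a natural number $U_v$ for each state $v$, with $N=\sum_vU_v$), $\#M_A(U)$ is also the number of monomials with nonzero coefficient in the expansion of the mixture likelihood $$\frac{N!}{\prod_v U_v!}\ \prod_v\bigl(\sigma_0\,\theta^{a_v}+\sigma_1\,\rho^{a_v}\bigr)^{U_v}$$ as a polynomial in the independent unknowns $\sigma_0$, $\sigma_1$, $\theta^{(i)}_j$, $\rho^{(i)}_j$.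 -/

import Mathlib

noncomputable section

namespace MixtureZonotope

open scoped Pointwise

section IntegerMatrix

/-! Notions attached to an integer matrix `A` with columns `a_v` and a data vector `U`. -/

variable {R C : Type*}

/-- The column `a_v` of `A`, as an integer vector. -/
def col (A : Matrix R C ℤ) (v : C) : R → ℤ := fun r => A r v

/-- An integer vector regarded as a real vector. -/
def toReal (b : R → ℤ) : R → ℝ := fun r => (b r : ℝ)

/-- The zonotope `Z_A(U) = ∑ v, U_v · [0, a_v]`, a Minkowski sum of segments. -/
def zonotope [Fintype C] (A : Matrix R C ℤ) (U : C → ℕ) : Set (R → ℝ) :=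
  ∑ v, (U v : ℝ) • segment ℝ (0 : R → ℝ) (toReal (col A v))

/-- The lattice `𝕃`, the image of `A : ℤ^C → ℤ^R`. -/
def lattice [Fintype C] (A : Matrix R C ℤ) : AddSubgroup (R → ℤ) :=
  (Matrix.mulVecLin A).range.toAddSubgroup

/-- The lattice points of the zonotope, `Z_A(U) ∩ 𝕃`. -/
def zonotopeLatticePoints [Fintype C] (A : Matrix R C ℤ) (U : C → ℕ) : Set (R → ℤ) :=
  {b | toReal b ∈ zonotope A U ∧ b ∈ lattice A}

open Classical in
/-- `φ_A(b, U)`: the sum of `∏ v, binom(U_v, x_v)` over all integer vectors `x` with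
`0 ≤ x_v ≤ U_v` and `A x = b`. -/
def phi [Fintype C] (A : Matrix R C ℤ) (b : R → ℤ) (U : C → ℕ) : ℕ :=
  ∑ x ∈ (Fintype.piFinset fun v => Finset.range (U v + 1)) with
      A.mulVec (fun v => (x v : ℤ)) = b,
    ∏ v, (U v).choose (x v)

/-- `M_A(U)`: the points `b` of `Z_A(U) ∩ 𝕃` with `φ_A(b, U) ≠ 0`. -/
def monomialSet [Fintype C] (A : Matrix R C ℤ) (U : C → ℕ) : Set (R → ℤ) :=
  {b | b ∈ zonotopeLatticePoints A U ∧ phi A b U ≠ 0}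

/-- The columns `a_v`, `v ∈ S`, are linearly independent over `ℝ`
(so two equal columns with different labels are dependent). -/
def IsIndep (A : Matrix R C ℤ) (S : Finset C) : Prop :=
  LinearIndepOn ℝ (fun v => toReal (col A v)) (S : Set C)

/-- `ℝS ∩ 𝕃`. -/
def spanLattice [Fintype C] (A : Matrix R C ℤ) (S : Finset C) : AddSubgroup (R → ℤ) where
  carrier := {b | toReal b ∈ Submodule.span ℝ ((fun v => toReal (col A v)) '' (S : Set C)) ∧
    b ∈ lattice A}
  zero_mem' := by
    refine ⟨?_, zero_mem _⟩
    have h : toReal (0 : R → ℤ) = 0 := by ext r; simp [toReal]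
    rw [h]
    exact zero_mem _
  add_mem' := by
    rintro b c ⟨hb, hb'⟩ ⟨hc, hc'⟩
    refine ⟨?_, add_mem hb' hc'⟩
    have h : toReal (b + c) = toReal b + toReal c := by ext r; simp [toReal]
    rw [h]
    exact add_mem hb hc
  neg_mem' := by
    rintro b ⟨hb, hb'⟩
    refine ⟨?_, neg_mem hb'⟩
    have h : toReal (-b) = -toReal b := by ext r; simp [toReal]
    rw [h]
    exact neg_mem hb

/-- `index(S) = [ℝS ∩ 𝕃 : ℤS]`. -/
def latticeIndex [Fintype C] (A : Matrix R C ℤ) (S : Finset C) : ℕ :=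
  (AddSubgroup.closure (col A '' (S : Set C))).relIndex (spanLattice A S)

/-- `A` is unimodular: every independent set of columns has index `1`. -/
def IsUnimodular [Fintype C] (A : Matrix R C ℤ) : Prop :=
  ∀ S : Finset C, IsIndep A S → latticeIndex A S = 1

open Classical in
/-- The family of all independent sets of columns (as sets of column labels). -/
def indepSets [Fintype C] (A : Matrix R C ℤ) : Finset (Finset C) :=
  {S | IsIndep A S}

end IntegerMatrix

section Model

/-! The independence model for `k` groups of variables: the `i`-th group has `s i` identically
distributed variables with values in `{0, …, t i}`. -/

variable {k : ℕ}

/-- The state space `∏ i, {0, …, t i} ^ (s i)`. -/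
abbrev State (s t : Fin k → ℕ) : Type := (i : Fin k) → Fin (s i) → Fin (t i + 1)

/-- The labels `(i, j)` of the model parameters `θ^{(i)}_j`, `0 ≤ j ≤ t i`. -/
abbrev Param (t : Fin k → ℕ) : Type := (i : Fin k) × Fin (t i + 1)

/-- The model matrix: its column `a_v` is the exponent vector of the monomial
`∏ i, ∏ j, θ^{(i)}_{v^{(i)}_j}`; see `stateMonomial_eq`. -/
def modelMatrix (s t : Fin k → ℕ) : Matrix (Param t) (State s t) ℤ :=
  fun p v => ((Finset.univ.filter fun j : Fin (s p.1) => v p.1 j = p.2).card : ℤ)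

/-- The unknowns of the mixture model: `σ_0, σ_1`, the `θ^{(i)}_j` and the `ρ^{(i)}_j`. -/
inductive MixVar (t : Fin k → ℕ) : Type
  | sigma (e : Fin 2)
  | theta (p : Param t)
  | rho (p : Param t)

/-- The monomial `∏ i, ∏ j, y^{(i)}_{v^{(i)}_j}` in the unknowns named by `y`. -/
def stateMonomial {s t : Fin k → ℕ} {V : Type} (y : Param t → V) (v : State s t) :
    MvPolynomial V ℚ :=
  ∏ i, ∏ j, MvPolynomial.X (y ⟨i, v i j⟩)

/-- The coordinate `p_v = σ_0 θ^{a_v} + σ_1 ρ^{a_v}` of the mixture model. -/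
def mixtureCoordinate {s t : Fin k → ℕ} (v : State s t) : MvPolynomial (MixVar t) ℚ :=
  MvPolynomial.X (MixVar.sigma 0) * stateMonomial MixVar.theta v +
    MvPolynomial.X (MixVar.sigma 1) * stateMonomial MixVar.rho v

/-- The likelihood function `N! / ∏ v, U_v! · ∏ v, p_v ^ U_v` of the mixture model, where
`N = ∑ v, U_v`, as a polynomial in the unknowns `σ, θ, ρ`. -/
def mixtureLikelihood {s t : Fin k → ℕ} (U : State s t → ℕ) : MvPolynomial (MixVar t) ℚ :=
  MvPolynomial.C (((∑ v, U v).factorial : ℚ) / ∏ v, ((U v).factorial : ℚ)) *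
    ∏ v, mixtureCoordinate v ^ U v

/-- The columns of `modelMatrix` are the exponent vectors of the monomials of the model. -/
theorem stateMonomial_eq {s t : Fin k → ℕ} {V : Type} (y : Param t → V) (v : State s t) :
    stateMonomial y v =
      ∏ p : Param t, (MvPolynomial.X (y p) : MvPolynomial V ℚ) ^ (modelMatrix s t p v).toNat := by
  unfold stateMonomial modelMatrix
  rw [Fintype.prod_sigma]
  refine Finset.prod_congr rfl fun i _ => ?_
  simp only [Int.toNat_natCast]
  rw [← Finset.prod_fiberwise Finset.univ (fun j => v i j)]
  refine Finset.prod_congr rfl fun c _ => ?_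
  rw [Finset.prod_congr rfl (g := fun _ => MvPolynomial.X (y ⟨i, c⟩)), Finset.prod_const]
  intro j hj
  rw [(Finset.mem_filter.mp hj).2]

end Model

end MixtureZonotope

end

/-! Everything is done for a finite family `a` in an abelian group `G`, by induction on `∑ v, U v`
through deletion and contraction. Raising one `U v` by 1 adds to the sum over independent sets
exactly the corresponding sum for the images of `a` in `G ⧸ ℤ a v` (`indepSum_add_single`). Both
bounds follow by comparing the newly gained points with that quotient. Among the `boxSums`, the new
points map onto the quotient's box sums, since every line in direction `a v` leaves a finite set
(`ncard_boxSums_add_le`). In the `rationalZonotope`, which contains the box sums, the new points map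
injectively into the quotient's zonotope, by convexity (`rationalZonotope_add_single`). Contraction
creates torsion, so `G` is not assumed torsion-free. Independence is taken over `ℤ`, and the index
of the empty set is the order of the torsion subgroup. The theorem is the case `G = lattice A`,
where `ℝS ∩ 𝕃` is the saturation of `ℤS`. For the mixture likelihood, the expansion has positive
coefficients, so no terms cancel, and the exponent of the term indexed by `x` is determined by `A x`
and conversely. -/

namespace MixtureZonotope

/-! ### Deletion and contraction for weighted sums over independent sets -/

section DeletionContraction

variable {G C : Type*} [AddCommGroup G]

open Classical in
/-- The sum of `w S * ∏ v ∈ S, U v` over all `ℤ`-linearly independent subfamilies `S` of `a`. -/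
noncomputable def indepSum [Fintype C] (w : Finset C → ℕ) (a : C → G) (U : C → ℕ) : ℕ :=
  ∑ S ∈ {S : Finset C | LinearIndepOn ℤ a (S : Set C)}, w S * ∏ v ∈ S, U v

/-- The combinations `∑ v, x v • a v` with `0 ≤ x ≤ U`. -/
def boxSums [Fintype C] (a : C → G) (U : C → ℕ) : Set G :=
  {b | ∃ x : C → ℕ, x ≤ U ∧ ∑ v, (x v : ℤ) • a v = b}

/-- The elements of `G` some positive multiple `m • b` of which is a combination of `a` with
coefficients between `0` and `m * U`. -/
def rationalZonotope [Fintype C] (a : C → G) (U : C → ℕ) : Set G :=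
  {b | ∃ m : ℤ, 0 < m ∧ ∃ x : C → ℤ, (∀ v, 0 ≤ x v ∧ x v ≤ m * U v) ∧
    ∑ v, x v • a v = m • b}

/-- The elements of `G` some nonzero multiple of which lies in `H`. -/
def saturation (H : Submodule ℤ G) : Submodule ℤ G where
  carrier := {b | ∃ m : ℤ, m ≠ 0 ∧ m • b ∈ H}
  zero_mem' := ⟨1, one_ne_zero, by simp⟩
  add_mem' := by
    rintro b c ⟨m, hm, hb⟩ ⟨n, hn, hc⟩
    refine ⟨m * n, mul_ne_zero hm hn, ?_⟩
    rw [zsmul_add]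
    refine add_mem ?_ ?_
    · rw [mul_comm, mul_smul]
      exact H.smul_mem n hb
    · rw [mul_smul]
      exact H.smul_mem m hc
  smul_mem' := by
    rintro k b ⟨m, hm, hb⟩
    exact ⟨m, hm, by rw [smul_comm]; exact H.smul_mem k hb⟩

/-- The index of the span of `a v`, `v ∈ S`, in its saturation. -/
noncomputable def spanIndex (a : C → G) (S : Finset C) : ℕ :=
  (Submodule.span ℤ (a '' (S : Set C))).toAddSubgroup.relIndex
    (saturation (Submodule.span ℤ (a '' (S : Set C)))).toAddSubgroup

theorem boxSums_subset_rationalZonotope [Fintype C] (a : C → G) (U : C → ℕ) :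
    boxSums a U ⊆ rationalZonotope a U := by
  rintro b ⟨x, hx, rfl⟩
  exact ⟨1, one_pos, fun v => x v, fun v => ⟨by positivity, by simpa using hx v⟩, by simp⟩

/-- Saturation commutes with preimage under a surjection, and preimages under a surjection preserve
relative index. -/
theorem relIndex_saturation_comap {G' : Type*} [AddCommGroup G']
    (f : G →ₗ[ℤ] G') (hf : Function.Surjective f) (H : Submodule ℤ G') :
    (H.comap f).toAddSubgroup.relIndex (saturation (H.comap f)).toAddSubgroup =
      H.toAddSubgroup.relIndex (saturation H).toAddSubgroup := by
  have h : (H.comap f).toAddSubgroup = H.toAddSubgroup.comap f.toAddMonoidHom := rfl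
  rw [h, AddSubgroup.relIndex_comap]
  congr 1
  ext y
  constructor
  · rintro ⟨x, ⟨m, hm, hx⟩, rfl⟩
    exact ⟨m, hm, by simpa using hx⟩
  · rintro ⟨m, hm, hy⟩
    obtain ⟨x, rfl⟩ := hf y
    exact ⟨x, ⟨m, hm, by simpa using hy⟩, rfl⟩

/-- The span upstairs contains `ker f`, hence is the full preimage of the span downstairs. This
makes the index weights compatible with contraction. -/
theorem spanIndex_insert {G' : Type*} [AddCommGroup G'] [DecidableEq C] (a : C → G) (v : C)
    (T : Finset C) (f : G →ₗ[ℤ] G') (hf : Function.Surjective f)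
    (hker : LinearMap.ker f = Submodule.span ℤ {a v}) :
    spanIndex a (insert v T) = spanIndex (f ∘ a) T := by
  have h : Submodule.span ℤ (a '' ((insert v T : Finset C) : Set C)) =
      (Submodule.span ℤ ((f ∘ a) '' (T : Set C))).comap f := by
    rw [Set.image_comp, Submodule.span_image, Submodule.comap_map_eq, hker, sup_comm,
      ← Submodule.span_union, ← Set.image_singleton, ← Set.image_union]
    simp
  unfold spanIndex
  rw [h, relIndex_saturation_comap f hf]

theorem linearIndepOn_insert_iff_comp {G' : Type*} [AddCommGroup G'] [DecidableEq C] {a : C → G}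
    {v : C} {T : Finset C} (ha : ∀ m : ℤ, m • a v = 0 → m = 0) (hv : v ∉ T) (f : G →ₗ[ℤ] G')
    (hf : Function.Surjective f) (hker : LinearMap.ker f = Submodule.span ℤ {a v}) :
    LinearIndepOn ℤ a ((insert v T : Finset C) : Set C) ↔ LinearIndepOn ℤ (f ∘ a) (T : Set C) := by
  have h := LinearIndepOn.quotient_iff_union (R := ℤ) (s := {v}) (t := (T : Set C)) (f := a)
    (LinearIndepOn.singleton' ha) (by simpa using hv)
  rw [Set.image_singleton, ← hker] at h
  rw [Finset.coe_insert, Set.insert_eq, ← h]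
  exact (LinearMap.linearIndependent_iff (f.quotKerEquivOfSurjective hf).toLinearMap
    (LinearEquiv.ker _)).symm

theorem prod_add_single [DecidableEq C] (U : C → ℕ) (v : C) (S : Finset C) :
    ∏ u ∈ S, (U + Pi.single v 1 : C → ℕ) u =
      ∏ u ∈ S, U u + if v ∈ S then ∏ u ∈ S.erase v, U u else 0 := by
  have h : ∀ T : Finset C, v ∉ T → ∏ u ∈ T, (U + Pi.single v 1 : C → ℕ) u = ∏ u ∈ T, U u := by
    intro T hT
    refine Finset.prod_congr rfl fun u hu => ?_
    have : u ≠ v := fun e => hT (e ▸ hu)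
    simp [this]
  split_ifs with hS
  · rw [← Finset.mul_prod_erase S _ hS, ← Finset.mul_prod_erase S U hS,
      h _ (Finset.notMem_erase v S)]
    simp [add_mul]
  · rw [h S hS, add_zero]

theorem indepSum_zero [Fintype C] (w : Finset C → ℕ) (a : C → G) : indepSum w a 0 = w ∅ := by
  classical
  unfold indepSum
  rw [Finset.sum_eq_single ∅]
  · simp
  · intro S _ hS
    obtain ⟨v, hv⟩ := Finset.nonempty_iff_ne_empty.mpr hS
    rw [Finset.prod_eq_zero hv rfl, mul_zero]
  · intro h
    simp at h

/-- A torsion element belongs to no `ℤ`-independent set, so `U v` never enters the sum. -/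
theorem indepSum_add_single_of_torsion [Fintype C] [DecidableEq C] (w : Finset C → ℕ) (a : C → G)
    (U : C → ℕ) (v : C) {m : ℤ} (hm : m ≠ 0) (ha : m • a v = 0) :
    indepSum w a (U + Pi.single v 1) = indepSum w a U := by
  classical
  unfold indepSum
  refine Finset.sum_congr rfl fun S hS => ?_
  rw [prod_add_single, if_neg, add_zero]
  intro hv
  have h := (Finset.mem_filter.mp hS).2
  exact hm (linearIndepOn_iff'.mp h {v} (fun _ => m) (by simpa using hv) (by simpa using ha) v
    (by simp))

/-- Each product is affine in `U v`. The increment collects the independent sets containing `v`, and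
erasing `v` matches these with the independent sets of the contraction. -/
theorem indepSum_add_single {G' : Type*} [AddCommGroup G'] [Fintype C] [DecidableEq C] (w w' : Finset C → ℕ) (a : C → G)
    (U : C → ℕ) (v : C) (ha : ∀ m : ℤ, m • a v = 0 → m = 0)
    (hw : ∀ T, w (insert v T) = w' T) (f : G →ₗ[ℤ] G') (hf : Function.Surjective f)
    (hker : LinearMap.ker f = Submodule.span ℤ {a v}) :
    indepSum w a (U + Pi.single v 1) =
      indepSum w a U + indepSum w' (f ∘ a) U := by
  classical
  unfold indepSum
  simp only [prod_add_single, mul_add, Finset.sum_add_distrib, mul_ite, mul_zero]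
  congr 1
  rw [← Finset.sum_filter, Finset.filter_filter]
  have hnot : ∀ T : Finset C,
      LinearIndepOn ℤ (f ∘ a) (T : Set C) → v ∉ T := by
    intro T hT hv
    refine hT.ne_zero (Finset.mem_coe.mpr hv) ?_
    rw [Function.comp_apply, ← LinearMap.mem_ker, hker]
    exact Submodule.mem_span_singleton_self _
  refine Finset.sum_nbij' (fun S => S.erase v) (fun T => insert v T) ?_ ?_ ?_ ?_ ?_
  · intro S hS
    obtain ⟨-, hS, hv⟩ := Finset.mem_filter.mp hS
    refine Finset.mem_filter.mpr ⟨Finset.mem_univ _, ?_⟩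
    rw [← linearIndepOn_insert_iff_comp ha (Finset.notMem_erase v S) f hf hker, Finset.insert_erase hv]
    exact hS
  · intro T hT
    have hT := (Finset.mem_filter.mp hT).2
    refine Finset.mem_filter.mpr ⟨Finset.mem_univ _, ?_, Finset.mem_insert_self v T⟩
    exact (linearIndepOn_insert_iff_comp ha (hnot T hT) f hf hker).mpr hT
  · intro S hS
    exact Finset.insert_erase (Finset.mem_filter.mp hS).2.2
  · intro T hT
    exact Finset.erase_insert (hnot T (Finset.mem_filter.mp hT).2)
  · intro S hS
    rw [← hw, Finset.insert_erase (Finset.mem_filter.mp hS).2.2]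

end DeletionContraction

end MixtureZonotope

namespace MixtureZonotope

/-! ### Lower bound: counting box sums -/

section LatticePointCount

universe u

variable {G : Type u} {C : Type*} [AddCommGroup G]

theorem finite_boxSums [Fintype C] (a : C → G) (U : C → ℕ) : (boxSums a U).Finite := by
  classical
  exact (Set.finite_Iic U).image fun x => ∑ v, (x v : ℤ) • a v

theorem boxSums_mono [Fintype C] (a : C → G) {U U' : C → ℕ} (h : U ≤ U') :
    boxSums a U ⊆ boxSums a U' := by
  rintro b ⟨x, hx, rfl⟩
  exact ⟨x, hx.trans h, rfl⟩

theorem add_mem_boxSums [Fintype C] [DecidableEq C] {a : C → G} {U : C → ℕ} {b : G}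
    (hb : b ∈ boxSums a U) (v : C) : b + a v ∈ boxSums a (U + Pi.single v 1) := by
  obtain ⟨x, hx, rfl⟩ := hb
  refine ⟨x + Pi.single v 1, add_le_add_left hx _, ?_⟩
  simp [add_smul, Finset.sum_add_distrib, Pi.single_apply]

theorem boxSums_comp {G' : Type*} [AddCommGroup G'] [Fintype C] (f : G →ₗ[ℤ] G') (a : C → G)
    (U : C → ℕ) : boxSums (f ∘ a) U = f '' boxSums a U := by
  ext y
  constructor
  · rintro ⟨x, hx, rfl⟩
    exact ⟨_, ⟨x, hx, rfl⟩, by simp⟩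
  · rintro ⟨_, ⟨x, hx, rfl⟩, rfl⟩
    exact ⟨x, hx, by simp⟩

/-- Starting from a point of `boxSums a U` and moving by `a v`, the first point outside this finite
set is a new point with the same image under `f`. -/
theorem ncard_boxSums_add_le {G' : Type*} [AddCommGroup G'] [Fintype C] [DecidableEq C]
    (a : C → G) (U : C → ℕ) (v : C) (ha : ∀ m : ℤ, m • a v = 0 → m = 0) (f : G →ₗ[ℤ] G')
    (hf : f (a v) = 0) :
    (boxSums a U).ncard + (boxSums (f ∘ a) U).ncard ≤
      (boxSums a (U + Pi.single v 1)).ncard := by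
  have hsub : boxSums a U ⊆ boxSums a (U + Pi.single v 1) :=
    boxSums_mono a (le_add_of_nonneg_right bot_le)
  have hfin := finite_boxSums a (U + Pi.single v 1)
  rw [← Set.ncard_sdiff_add_ncard_of_subset hsub hfin, add_comm]
  refine Nat.add_le_add_right ?_ _
  refine (Set.ncard_le_ncard ?_ (hfin.sdiff.image f)).trans (Set.ncard_image_le hfin.sdiff)
  rw [boxSums_comp]
  rintro _ ⟨b, hb, rfl⟩
  have hinj : Function.Injective fun j : ℕ => b + (j : ℤ) • a v := by
    intro i j hij
    have h : ((i : ℤ) - j) • a v = 0 := by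
      rw [sub_smul, sub_eq_zero]
      exact add_left_cancel hij
    have := ha _ h
    lia
  have hJ : {j : ℕ | b + (j : ℤ) • a v ∉ boxSums a U}.Nonempty := by
    by_contra h
    rw [Set.not_nonempty_iff_eq_empty, Set.eq_empty_iff_forall_notMem] at h
    exact Set.infinite_of_injective_forall_mem hinj (fun j => not_not.mp (h j))
      (finite_boxSums a U)
  classical
  -- The exit time is positive because `b` itself lies in the set; `j` is the last time before the
  -- exit.
  obtain ⟨j, hj⟩ : ∃ j, Nat.find hJ = j + 1 := by
    refine Nat.exists_eq_succ_of_ne_zero fun h => ?_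
    have := Nat.find_spec hJ
    rw [h] at this
    simp [hb] at this
  have h0 : b + (j : ℤ) • a v ∈ boxSums a U := not_not.mp (Nat.find_min hJ (m := j) (by lia))
  have h1 := Nat.find_spec hJ
  rw [hj] at h1
  refine ⟨b + ((j + 1 : ℕ) : ℤ) • a v, ⟨?_, h1⟩, by simp [hf]⟩
  have := add_mem_boxSums h0 v
  rwa [add_assoc, ← add_one_zsmul] at this

theorem exists_eq_add_single [Fintype C] [DecidableEq C] {N : ℕ} {U : C → ℕ}
    (hU : ∑ v, U v = N + 1) : ∃ (U' : C → ℕ) (v : C), U = U' + Pi.single v 1 ∧ ∑ v, U' v = N := by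
  obtain ⟨v, -, hv⟩ : ∃ v ∈ Finset.univ, U v ≠ 0 := by
    refine Finset.exists_ne_zero_of_sum_ne_zero ?_
    lia
  have h : U = (U - Pi.single v 1) + Pi.single v 1 := by
    refine (tsub_add_cancel_of_le fun u => ?_).symm
    rcases eq_or_ne u v with rfl | h
    · simpa using Nat.one_le_iff_ne_zero.mpr hv
    · simp [h]
  refine ⟨_, v, h, ?_⟩
  rw [h] at hU
  simp only [Pi.add_apply, Finset.sum_add_distrib, Finset.sum_pi_single', Finset.mem_univ,
    if_true] at hU
  simpa using hU

/-- The cosets of `ℤ c`. -/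
abbrev lineQuotient (c : G) : G →ₗ[ℤ] G ⧸ AddSubgroup.zmultiples c :=
  (QuotientAddGroup.mk' (AddSubgroup.zmultiples c)).toIntLinearMap

theorem lineQuotient_surjective (c : G) : Function.Surjective (lineQuotient c) :=
  QuotientAddGroup.mk'_surjective _

theorem lineQuotient_eq_zero {c x : G} : lineQuotient c x = 0 ↔ ∃ m : ℤ, m • c = x := by
  rw [← AddSubgroup.mem_zmultiples_iff]
  exact QuotientAddGroup.eq_zero_iff x

theorem ker_lineQuotient (c : G) : LinearMap.ker (lineQuotient c) = Submodule.span ℤ {c} := by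
  ext x
  rw [LinearMap.mem_ker, lineQuotient_eq_zero, Submodule.mem_span_singleton]

theorem indepSum_one_le_ncard_boxSums [Fintype C] (a : C → G) (U : C → ℕ) :
    indepSum (fun _ => 1) a U ≤ (boxSums a U).ncard := by
  classical
  -- The group must vary in the induction, as the contraction lives in a quotient of `G`.
  induction hN : ∑ v, U v generalizing G U with
  | zero =>
    obtain rfl : U = 0 := by
      funext v
      exact (Finset.sum_eq_zero_iff.mp hN) v (Finset.mem_univ v)
    rw [indepSum_zero, Nat.one_le_iff_ne_zero, ← Nat.pos_iff_ne_zero, Set.ncard_pos (finite_boxSums a 0)]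
    exact ⟨_, 0, le_rfl, rfl⟩
  | succ N ih =>
    obtain ⟨U, v, rfl, hU⟩ := exists_eq_add_single hN
    by_cases ha : ∀ m : ℤ, m • a v = 0 → m = 0
    · rw [indepSum_add_single _ (fun _ => 1) a U v ha (fun _ => rfl) (lineQuotient (a v))
        (lineQuotient_surjective _) (ker_lineQuotient _)]
      exact (add_le_add (ih _ _ hU) (ih _ _ hU)).trans
        (ncard_boxSums_add_le a U v ha _ (lineQuotient_eq_zero.mpr ⟨1, one_zsmul _⟩))
    · push Not at ha
      obtain ⟨m, hm, hm0⟩ := ha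
      rw [indepSum_add_single_of_torsion _ a U v hm0 hm]
      exact (ih _ _ hU).trans (Set.ncard_le_ncard (boxSums_mono a (le_add_of_nonneg_right bot_le))
        (finite_boxSums _ _))

end LatticePointCount

end MixtureZonotope

namespace MixtureZonotope

/-! ### Upper bound: counting points of the rational zonotope -/

section LatticePointCount

universe u

variable {G : Type u} {C : Type*} [AddCommGroup G]

theorem rationalZonotope_mono [Fintype C] (a : C → G) {U U' : C → ℕ} (h : U ≤ U') :
    rationalZonotope a U ⊆ rationalZonotope a U' := by
  rintro b ⟨m, hm, x, hx, hb⟩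
  refine ⟨m, hm, x, fun v => ⟨(hx v).1, (hx v).2.trans ?_⟩, hb⟩
  have := h v
  gcongr

/-- Convexity: `b` has one representation with `v`-coefficient at least 0, and a second, obtained by
shifting that of `b + j • a v`, with `v`-coefficient at most `U v`. Either one is admissible already
or a convex combination is. All coefficients are scaled by a common denominator. -/
theorem mem_rationalZonotope_of_add_mem [Fintype C] [DecidableEq C] {a : C → G} {U : C → ℕ}
    {v : C} {b : G} {j : ℤ} (hj : 0 < j) (hb : b ∈ rationalZonotope a (U + Pi.single v 1))
    (hb' : b + j • a v ∈ rationalZonotope a (U + Pi.single v 1)) : b ∈ rationalZonotope a U := by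
  obtain ⟨m, hm, x, hx, hxb⟩ := hb
  obtain ⟨m', hm', y, hy, hyb⟩ := hb'
  have hxv : ∀ u, u ≠ v → x u ≤ m * U u := fun u hu => by simpa [hu] using (hx u).2
  have hyv : ∀ u, u ≠ v → y u ≤ m' * U u := fun u hu => by simpa [hu] using (hy u).2
  have hyv' : y v ≤ m' * (U v + 1) := by simpa using (hy v).2
  set z : C → ℤ := y - Pi.single v (m' * j) with hz
  have hzu : ∀ u, u ≠ v → z u = y u := fun u hu => by simp [hz, hu]
  have hzv : z v = y v - m' * j := by simp [hz]
  have hzb : ∑ u, z u • a u = m' • b := by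
    simp only [hz, Pi.sub_apply, sub_smul, Finset.sum_sub_distrib, hyb]
    simp [Pi.single_apply, mul_smul]
  have hzle : z v ≤ m' * U v := by
    -- As `j ≥ 1`, the shift absorbs the extra unit in the bound at `v`.
    have : m' * 1 ≤ m' * j := by gcongr; lia
    rw [hzv]
    linarith
  by_cases h1 : x v ≤ m * U v
  · refine ⟨m, hm, x, fun u => ⟨(hx u).1, ?_⟩, hxb⟩
    rcases eq_or_ne u v with rfl | hu
    exacts [h1, hxv u hu]
  by_cases h2 : 0 ≤ z v
  · refine ⟨m', hm', z, fun u => ?_, hzb⟩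
    rcases eq_or_ne u v with rfl | hu
    · exact ⟨h2, hzle⟩
    · rw [hzu u hu]
      exact ⟨(hy u).1, hyv u hu⟩
  push Not at h1 h2
  have hα : 0 ≤ m' * U v - z v := by linarith
  have hβ : 0 ≤ x v - m * U v := by linarith
  have hx0 : 0 < x v := lt_of_le_of_lt (by positivity) h1
  -- The weights make the new coefficient at `v` exactly `U v` times the new multiplier, which
  -- simplifies to `m' * x v - m * z v > 0`.
  refine ⟨(m' * U v - z v) * m + (x v - m * U v) * m', ?_,
    fun u => (m' * U v - z v) * x u + (x v - m * U v) * z u, fun u => ?_, ?_⟩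
  · have e1 : 0 < m' * x v := mul_pos hm' hx0
    have e2 : 0 < m * -z v := mul_pos hm (by linarith)
    linarith
  · rcases eq_or_ne u v with rfl | hu
    · have e1 : 0 ≤ m' * x u := by positivity
      have e2 : 0 ≤ m * -z u := mul_nonneg hm.le (by linarith)
      have e3 : (0 : ℤ) ≤ U u * (m' * x u + m * -z u) := by positivity
      constructor <;> linarith
    · beta_reduce
      rw [hzu u hu]
      have := (hx u).1
      have := (hy u).1
      refine ⟨by positivity, ?_⟩
      have e1 := mul_le_mul_of_nonneg_left (hxv u hu) hα
      have e2 := mul_le_mul_of_nonneg_left (hyv u hu) hβ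
      linarith
  · simp only [add_smul, Finset.sum_add_distrib, mul_smul, ← Finset.smul_sum, hxb, hzb]

theorem mem_rationalZonotope_comp {G' : Type*} [AddCommGroup G'] [Fintype C] [DecidableEq C]
    {a : C → G} {U : C → ℕ} {v : C} {b : G} {f : G →ₗ[ℤ] G'} (hf : f (a v) = 0)
    (hb : b ∈ rationalZonotope a (U + Pi.single v 1)) : f b ∈ rationalZonotope (f ∘ a) U := by
  obtain ⟨m, hm, x, hx, hb⟩ := hb
  refine ⟨m, hm, Function.update x v 0, fun u => ?_, ?_⟩
  · rcases eq_or_ne u v with rfl | hu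
    · rw [Function.update_self]
      exact ⟨le_rfl, by positivity⟩
    · simpa [hu] using hx u
  · rw [← map_zsmul, ← hb, map_sum]
    refine Finset.sum_congr rfl fun u _ => ?_
    rcases eq_or_ne u v with rfl | hu
    · simp [hf]
    · simp [hu]

/-- Scaling a representation by `|m|` kills the term at `v`, whose coefficient can then be reset to
0. -/
theorem rationalZonotope_add_single_of_torsion [Fintype C] [DecidableEq C] {a : C → G}
    (U : C → ℕ) {v : C} {m : ℤ} (hm : m ≠ 0) (ha : m • a v = 0) :
    rationalZonotope a (U + Pi.single v 1) = rationalZonotope a U := by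
  refine Set.Subset.antisymm ?_ (rationalZonotope_mono a (le_add_of_nonneg_right bot_le))
  rintro b ⟨n, hn, x, hx, hb⟩
  have hm' : 0 < |m| := abs_pos.mpr hm
  have ha' : |m| • a v = 0 := by
    rcases abs_choice m with h | h <;> simp [h, ha]
  refine ⟨|m| * n, by positivity, Function.update (fun u => |m| * x u) v 0, fun u => ?_, ?_⟩
  · rcases eq_or_ne u v with rfl | hu
    · rw [Function.update_self]
      exact ⟨le_rfl, by positivity⟩
    · obtain ⟨h0, h1⟩ := hx u
      rw [Function.update_of_ne hu, mul_assoc]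
      refine ⟨by positivity, ?_⟩
      gcongr
      simpa [hu] using h1
  · rw [mul_smul, ← hb, Finset.smul_sum]
    refine Finset.sum_congr rfl fun u _ => ?_
    rcases eq_or_ne u v with rfl | hu
    · rw [smul_comm, ha']
      simp
    · simp [hu, mul_smul]

theorem rationalZonotope_add_single [Fintype C] [DecidableEq C] (a : C → G) (U : C → ℕ) (v : C)
    (hfin : (rationalZonotope a U).Finite)
    (hfin' : (rationalZonotope (lineQuotient (a v) ∘ a) U).Finite) :
    (rationalZonotope a (U + Pi.single v 1)).Finite ∧
      (rationalZonotope a (U + Pi.single v 1)).ncard ≤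
        (rationalZonotope a U).ncard + (rationalZonotope (lineQuotient (a v) ∘ a) U).ncard := by
  have hsub : rationalZonotope a U ⊆ rationalZonotope a (U + Pi.single v 1) :=
    rationalZonotope_mono a (le_add_of_nonneg_right bot_le)
  have hmaps : Set.MapsTo (lineQuotient (a v))
      (rationalZonotope a (U + Pi.single v 1) \ rationalZonotope a U)
      (rationalZonotope (lineQuotient (a v) ∘ a) U) := fun b hb =>
    mem_rationalZonotope_comp (lineQuotient_eq_zero.mpr ⟨1, one_zsmul _⟩) hb.1
  have hinj : Set.InjOn (lineQuotient (a v))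
      (rationalZonotope a (U + Pi.single v 1) \ rationalZonotope a U) := by
    rintro b hb c hc hbc
    rw [← sub_eq_zero, ← map_sub, lineQuotient_eq_zero] at hbc
    obtain ⟨j, hj⟩ := hbc
    -- Of two distinct points on a line in direction `a v`, the earlier one would already lie in the
    -- smaller zonotope.
    rcases lt_trichotomy 0 j with h | rfl | h
    · refine absurd (mem_rationalZonotope_of_add_mem h hc.1 ?_) hc.2
      rw [hj, add_sub_cancel]
      exact hb.1
    · rw [zero_smul] at hj
      exact sub_eq_zero.mp hj.symm
    · refine absurd (mem_rationalZonotope_of_add_mem (neg_pos.mpr h) hb.1 ?_) hb.2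
      rw [neg_smul, hj, neg_sub, add_sub_cancel]
      exact hc.1
  have hdiff := Set.Finite.of_injOn hmaps hinj hfin'
  have hZ : (rationalZonotope a (U + Pi.single v 1)).Finite := by
    rw [← Set.sdiff_union_of_subset hsub]
    exact hdiff.union hfin
  refine ⟨hZ, ?_⟩
  rw [← Set.ncard_sdiff_add_ncard_of_subset hsub hZ, add_comm]
  exact Nat.add_le_add_left (Set.ncard_le_ncard_of_injOn _ hmaps hinj hfin') _

theorem rationalZonotope_zero [Fintype C] (a : C → G) :
    rationalZonotope a 0 = (saturation (⊥ : Submodule ℤ G) : Set G) := by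
  ext b
  constructor
  · rintro ⟨m, hm, x, hx, hb⟩
    refine ⟨m, hm.ne', ?_⟩
    rw [Submodule.mem_bot, ← hb]
    refine Finset.sum_eq_zero fun v _ => ?_
    have h : x v = 0 := le_antisymm (by simpa using (hx v).2) (hx v).1
    rw [h, zero_smul]
  · rintro ⟨m, hm, hb⟩
    rw [Submodule.mem_bot] at hb
    refine ⟨|m|, abs_pos.mpr hm, 0, by simp, ?_⟩
    rcases abs_choice m with h | h <;> simp [h, hb]

theorem finite_saturation_bot [Module.Finite ℤ G] :
    (saturation (⊥ : Submodule ℤ G) : Set G).Finite := by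
  suffices Finite (saturation (⊥ : Submodule ℤ G)) from Set.toFinite _
  refine Module.finite_of_fg_torsion _ ?_
  rintro ⟨b, m, hm, hb⟩
  exact ⟨⟨m, mem_nonZeroDivisors_of_ne_zero hm⟩, Subtype.ext hb⟩

/-- Finiteness is carried through the induction because `ncard` is 0 on infinite sets. At `U = 0`
both sides are the order of the torsion subgroup. -/
theorem ncard_rationalZonotope_le [Fintype C] [Module.Finite ℤ G] (a : C → G) (U : C → ℕ) :
    (rationalZonotope a U).Finite ∧
      (rationalZonotope a U).ncard ≤ indepSum (spanIndex a) a U := by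
  classical
  induction hN : ∑ v, U v generalizing G U with
  | zero =>
    obtain rfl : U = 0 := by
      funext v
      exact (Finset.sum_eq_zero_iff.mp hN) v (Finset.mem_univ v)
    rw [indepSum_zero, rationalZonotope_zero]
    refine ⟨finite_saturation_bot, ?_⟩
    have h : (⊥ : Submodule ℤ G).toAddSubgroup = ⊥ := rfl
    rw [spanIndex, Finset.coe_empty, Set.image_empty, Submodule.span_empty, h,
      AddSubgroup.relIndex_bot_left]
    exact le_rfl
  | succ N ih =>
    obtain ⟨U, v, rfl, hU⟩ := exists_eq_add_single hN
    by_cases ha : ∀ m : ℤ, m • a v = 0 → m = 0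
    · have hfg : Module.Finite ℤ (G ⧸ AddSubgroup.zmultiples (a v)) :=
        Module.Finite.of_surjective _ (lineQuotient_surjective (a v))
      obtain ⟨h1, h2⟩ := ih a U hU
      obtain ⟨h3, h4⟩ := ih (lineQuotient (a v) ∘ a) U hU
      obtain ⟨h5, h6⟩ := rationalZonotope_add_single a U v h1 h3
      refine ⟨h5, h6.trans ?_⟩
      rw [indepSum_add_single _ _ a U v ha (fun T => spanIndex_insert a v T (lineQuotient (a v))
        (lineQuotient_surjective _) (ker_lineQuotient _)) (lineQuotient (a v))
        (lineQuotient_surjective _) (ker_lineQuotient _)]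
      exact add_le_add h2 h4
    · push Not at ha
      obtain ⟨m, hm, hm0⟩ := ha
      rw [indepSum_add_single_of_torsion _ a U v hm0 hm,
        rationalZonotope_add_single_of_torsion U hm0 hm]
      exact ih a U hU

end LatticePointCount

end MixtureZonotope

namespace MixtureZonotope

open scoped Pointwise

/-! ### From real spans of columns to the abelian group `lattice A` -/

section IntegerMatrix

variable {R C : Type*}

theorem mulVec_eq_sum_smul_col [Fintype C] (A : Matrix R C ℤ) (x : C → ℤ) :
    A.mulVec x = ∑ v, x v • col A v := by
  ext r
  simp [Matrix.mulVec, dotProduct, col, mul_comm]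

theorem toReal_add (b c : R → ℤ) : toReal (b + c) = toReal b + toReal c := by
  ext r
  simp [toReal]

theorem toReal_sum {ι : Type*} (s : Finset ι) (b : ι → R → ℤ) :
    toReal (∑ i ∈ s, b i) = ∑ i ∈ s, toReal (b i) := by
  ext r
  simp [toReal]

theorem toReal_smul (m : ℤ) (b : R → ℤ) : toReal (m • b) = (m : ℝ) • toReal b := by
  ext r
  simp [toReal]

theorem toReal_mulVec_mem_zonotope [Fintype C] (A : Matrix R C ℤ) {U x : C → ℕ} (hx : x ≤ U) :
    toReal (A.mulVec fun v => (x v : ℤ)) ∈ zonotope A U := by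
  rw [mulVec_eq_sum_smul_col, toReal_sum]
  refine Set.finsetSum_mem_finsetSum _ _ _ fun v _ => ?_
  have hxv : (x v : ℝ) ≤ U v := by exact_mod_cast hx v
  rw [toReal_smul]
  rcases Nat.eq_zero_or_pos (U v) with h | h
  · have h0 : x v = 0 := Nat.le_zero.mp (h ▸ hx v)
    rw [h0]
    exact ⟨0, left_mem_segment ℝ _ _, by simp⟩
  · have hU : (0 : ℝ) < U v := by exact_mod_cast h
    refine ⟨((x v : ℝ) / U v) • toReal (col A v), ?_, ?_⟩
    · rw [segment_eq_image]
      exact ⟨(x v : ℝ) / U v, ⟨by positivity, (div_le_one hU).mpr hxv⟩, by simp⟩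
    · simp only [smul_smul, mul_div_cancel₀ _ hU.ne']
      simp

theorem phi_ne_zero_iff [Fintype C] {A : Matrix R C ℤ} {b : R → ℤ} {U : C → ℕ} :
    phi A b U ≠ 0 ↔ b ∈ boxSums (col A) U := by
  classical
  unfold phi
  rw [← Nat.pos_iff_ne_zero, Finset.sum_pos_iff]
  simp only [Finset.mem_filter, Fintype.mem_piFinset, Finset.mem_range, Nat.lt_succ_iff,
    mulVec_eq_sum_smul_col]
  constructor
  · rintro ⟨x, ⟨hx, hb⟩, -⟩
    exact ⟨x, hx, hb⟩
  · rintro ⟨x, hx, hb⟩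
    exact ⟨x, ⟨hx, hb⟩, Finset.prod_pos fun v _ => Nat.choose_pos (hx v)⟩

/-- A nonzero `phi` provides an integer point of the box over `b`, which already forces membership
in the zonotope and in the lattice. -/
theorem monomialSet_eq [Fintype C] (A : Matrix R C ℤ) (U : C → ℕ) :
    monomialSet A U = boxSums (col A) U := by
  ext b
  refine ⟨fun h => phi_ne_zero_iff.mp h.2, fun h => ⟨?_, phi_ne_zero_iff.mpr h⟩⟩
  obtain ⟨x, hx, rfl⟩ := h
  rw [← mulVec_eq_sum_smul_col A fun v => (x v : ℤ)]
  exact ⟨toReal_mulVec_mem_zonotope A hx, _, rfl⟩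

theorem isIndep_iff [Finite R] {A : Matrix R C ℤ} {S : Finset C} :
    IsIndep A S ↔ LinearIndepOn ℤ (col A) (S : Set C) :=
  linearIndependent_algebraMap_comp_iff (R := ℤ) (S := ℝ) (v := fun v : (S : Set C) => col A v)

/-- The column `a_v` as an element of the lattice `𝕃`. -/
def latticeCol [Fintype C] (A : Matrix R C ℤ) (v : C) : lattice A :=
  ⟨col A v, by
    classical
    exact ⟨Pi.single v 1, by ext r; simp [col]⟩⟩

theorem linearIndepOn_latticeCol_iff [Fintype C] {A : Matrix R C ℤ} {S : Finset C} :
    LinearIndepOn ℤ (latticeCol A) (S : Set C) ↔ LinearIndepOn ℤ (col A) (S : Set C) :=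
  (LinearMap.linearIndependent_iff (lattice A).subtype.toIntLinearMap
    (LinearMap.ker_eq_bot.mpr Subtype.val_injective)).symm

theorem indepSets_sum_eq_indepSum [Fintype C] [Finite R] (A : Matrix R C ℤ) (U : C → ℕ)
    {w w' : Finset C → ℕ} (hw : ∀ S, IsIndep A S → w S = w' S) :
    ∑ S ∈ indepSets A, w S * ∏ v ∈ S, U v = indepSum w' (latticeCol A) U := by
  unfold indepSets indepSum
  refine Finset.sum_congr ?_ fun S hS => ?_
  · ext S
    simp only [Finset.mem_filter, Finset.mem_univ, true_and, linearIndepOn_latticeCol_iff,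
      isIndep_iff]
  · rw [hw S]
    simpa [linearIndepOn_latticeCol_iff, isIndep_iff] using hS

theorem toReal_mem_span_iff [Finite R] {A : Matrix R C ℤ} {S : Finset C} (hS : IsIndep A S)
    {b : R → ℤ} :
    toReal b ∈ Submodule.span ℝ ((fun v => toReal (col A v)) '' (S : Set C)) ↔
      ∃ m : ℤ, m ≠ 0 ∧ m • b ∈ Submodule.span ℤ (col A '' (S : Set C)) := by
  constructor
  · intro h
    by_contra hcon
    push Not at hcon
    -- If no nonzero multiple of `b` lies in the integer span, adjoining `b` preserves independence
    -- over `ℤ`, hence over `ℝ`, which contradicts `h`.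
    have hind : LinearIndepOn ℤ id (insert b (col A '' (S : Set C))) :=
      (isIndep_iff.mp hS).id_image.insert' fun m hm => by
        by_contra hm0
        exact hcon m hm0 (by simpa using hm)
    have hreal : LinearIndepOn ℝ toReal (insert b (col A '' (S : Set C))) :=
      (linearIndependent_algebraMap_comp_iff (R := ℤ) (S := ℝ)
        (v := fun c : (insert b (col A '' (S : Set C)) : Set (R → ℤ)) => (c : R → ℤ))).mpr hind
    have hb : b ∉ col A '' (S : Set C) := fun hb =>
      hcon 1 one_ne_zero (by simpa using Submodule.subset_span hb)
    refine ((linearIndepOn_insert hb).mp hreal).2 ?_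
    rwa [Set.image_image]
  · rintro ⟨m, hm, h⟩
    have hm' : (m : ℝ) ≠ 0 := by exact_mod_cast hm
    rw [← Submodule.smul_mem_iff _ hm', ← toReal_smul]
    generalize m • b = c at h
    induction h using Submodule.span_induction with
    | mem c hc =>
      obtain ⟨v, hv, rfl⟩ := hc
      exact Submodule.subset_span ⟨v, hv, rfl⟩
    | zero =>
      have h0 : toReal (0 : R → ℤ) = 0 := by simpa using toReal_smul 0 (0 : R → ℤ)
      rw [h0]
      exact zero_mem _
    | add c c' _ _ hc hc' =>
      rw [toReal_add]
      exact add_mem hc hc'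
    | smul n c _ hc =>
      rw [toReal_smul]
      exact Submodule.smul_mem _ _ hc

/-- By `toReal_mem_span_iff`, `ℝS ∩ 𝕃` is the saturation of `ℤS` within `𝕃`; the injective inclusion
of `𝕃` preserves the relative index. -/
theorem latticeIndex_eq_spanIndex [Fintype C] [Finite R] {A : Matrix R C ℤ} {S : Finset C}
    (hS : IsIndep A S) : latticeIndex A S = spanIndex (latticeCol A) S := by
  have hmap : (Submodule.span ℤ (latticeCol A '' (S : Set C))).map
      (lattice A).subtype.toIntLinearMap = Submodule.span ℤ (col A '' (S : Set C)) := by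
    rw [Submodule.map_span, ← Set.image_comp]
    rfl
  have hmem : ∀ b : lattice A, (b : R → ℤ) ∈ Submodule.span ℤ (col A '' (S : Set C)) ↔
      b ∈ Submodule.span ℤ (latticeCol A '' (S : Set C)) := by
    intro b
    rw [← hmap]
    constructor
    · rintro ⟨c, hc, hcb⟩
      rwa [← Subtype.ext hcb]
    · exact fun h => ⟨b, h, rfl⟩
  unfold latticeIndex spanIndex
  rw [← AddSubgroup.relIndex_map_map_of_injective _ _ (lattice A).subtype_injective]
  congr 1
  · rw [← Submodule.span_int_eq_addSubgroupClosure, ← hmap]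
    rfl
  · ext b
    constructor
    · rintro ⟨hb, hb'⟩
      obtain ⟨m, hm, h⟩ := (toReal_mem_span_iff hS).mp hb
      exact ⟨⟨b, hb'⟩, ⟨m, hm, (hmem (m • ⟨b, hb'⟩)).mp h⟩, rfl⟩
    · rintro ⟨b, ⟨m, hm, h⟩, rfl⟩
      exact ⟨(toReal_mem_span_iff hS).mpr ⟨m, hm, (hmem (m • b)).mpr h⟩, b.2⟩

theorem boxSums_col [Fintype C] (A : Matrix R C ℤ) (U : C → ℕ) :
    boxSums (col A) U = (lattice A).subtype '' boxSums (latticeCol A) U :=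
  boxSums_comp (lattice A).subtype.toIntLinearMap (latticeCol A) U

theorem ncard_monomialSet [Fintype C] (A : Matrix R C ℤ) (U : C → ℕ) :
    (monomialSet A U).ncard = (boxSums (latticeCol A) U).ncard := by
  rw [monomialSet_eq, boxSums_col, Set.ncard_image_of_injective _ (lattice A).subtype_injective]

theorem finite_monomialSet [Fintype C] (A : Matrix R C ℤ) (U : C → ℕ) :
    (monomialSet A U).Finite := by
  rw [monomialSet_eq]
  exact finite_boxSums _ _

/-- `#M_A(U)` is at least the sum of `∏ v ∈ S, U v` over the independent sets `S`. -/
theorem sum_indepSets_le_ncard_monomialSet [Fintype C] [Finite R] (A : Matrix R C ℤ)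
    (U : C → ℕ) : ∑ S ∈ indepSets A, ∏ v ∈ S, U v ≤ (monomialSet A U).ncard := by
  have h := indepSets_sum_eq_indepSum A U (w := fun _ => 1) (w' := fun _ => 1) fun _ _ => rfl
  simp only [one_mul] at h
  rw [h, ncard_monomialSet]
  exact indepSum_one_le_ncard_boxSums _ _

theorem ncard_monomialSet_le_sum_latticeIndex [Fintype C] [Finite R] (A : Matrix R C ℤ)
    (U : C → ℕ) :
    (monomialSet A U).ncard ≤ ∑ S ∈ indepSets A, latticeIndex A S * ∏ v ∈ S, U v := by
  have hfg : Module.Finite ℤ (lattice A) :=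
    inferInstanceAs (Module.Finite ℤ (LinearMap.range (Matrix.mulVecLin A)))
  rw [indepSets_sum_eq_indepSum A U fun S hS => latticeIndex_eq_spanIndex hS, ncard_monomialSet]
  obtain ⟨hfin, hle⟩ := ncard_rationalZonotope_le (latticeCol A) U
  exact (Set.ncard_le_ncard (boxSums_subset_rationalZonotope _ _) hfin).trans hle

theorem sum_indepSets_eq_of_isUnimodular [Fintype C] {A : Matrix R C ℤ} (hA : IsUnimodular A)
    (U : C → ℕ) :
    ∑ S ∈ indepSets A, ∏ v ∈ S, U v =
      ∑ S ∈ indepSets A, latticeIndex A S * ∏ v ∈ S, U v := by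
  refine Finset.sum_congr rfl fun S hS => ?_
  rw [hA S (by simpa [indepSets] using hS), one_mul]

end IntegerMatrix

end MixtureZonotope

namespace MixtureZonotope

theorem card_image_le_card_image {ι α β : Type*} [DecidableEq α] [DecidableEq β] {s : Finset ι}
    {f : ι → α} {g : ι → β} (h : ∀ x ∈ s, ∀ y ∈ s, g x = g y → f x = f y) :
    (s.image f).card ≤ (s.image g).card := by
  rcases isEmpty_or_nonempty ι with hι | hι
  · simp [Finset.eq_empty_of_isEmpty s]
  refine (Finset.card_le_card ?_).trans
    (Finset.card_image_le (f := fun b => f (Function.invFunOn g s b)))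
  intro a ha
  obtain ⟨x, hx, rfl⟩ := Finset.mem_image.mp ha
  refine Finset.mem_image.mpr ⟨g x, Finset.mem_image_of_mem g hx, ?_⟩
  have hex : ∃ y ∈ (s : Set ι), g y = g x := ⟨x, hx, rfl⟩
  exact h _ (Function.invFunOn_mem hex) x hx (Function.invFunOn_eq hex)

theorem support_sum_monomial_of_pos {ι σ : Type*} [DecidableEq σ] (s : Finset ι)
    (e : ι → σ →₀ ℕ) (c : ι → ℚ) (hc : ∀ x ∈ s, 0 < c x) :
    (∑ x ∈ s, MvPolynomial.monomial (e x) (c x)).support = s.image e := by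
  ext m
  rw [MvPolynomial.mem_support_iff, MvPolynomial.coeff_sum, Finset.mem_image]
  simp only [MvPolynomial.coeff_monomial]
  have hnn : ∀ x ∈ s, 0 ≤ if e x = m then c x else 0 := by
    intro x hx
    split_ifs
    exacts [(hc x hx).le, le_rfl]
  rw [Ne, Finset.sum_eq_zero_iff_of_nonneg hnn]
  push Not
  constructor
  · rintro ⟨x, hx, h⟩
    exact ⟨x, hx, by_contra fun hne => h (if_neg hne)⟩
  · rintro ⟨x, hx, h⟩
    exact ⟨x, hx, by rw [if_pos h]; exact (hc x hx).ne'⟩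

/-! ### Monomials of the mixture likelihood -/

section Model

variable {k : ℕ} {s t : Fin k → ℕ}

/-- The exponent vector of `stateMonomial y v`. -/
noncomputable def stateExponent {V : Type} (y : Param t → V) (v : State s t) : V →₀ ℕ :=
  ∑ p : Param t, Finsupp.single (y p) (modelMatrix s t p v).toNat

theorem stateMonomial_eq_monomial {V : Type} (y : Param t → V) (v : State s t) :
    stateMonomial y v = MvPolynomial.monomial (stateExponent y v) 1 := by
  rw [stateMonomial_eq, stateExponent, MvPolynomial.monomial_sum_one]
  simp only [MvPolynomial.X_pow_eq_monomial]

/-- The exponent vector of the term of `mixtureLikelihood U` in which, for each state `v`, the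
summand `σ_0 θ^{a_v}` is chosen `x v` times and `σ_1 ρ^{a_v}` is chosen `U v - x v` times. -/
noncomputable def mixtureExponent (U x : State s t → ℕ) : MixVar t →₀ ℕ :=
  ∑ v, (x v • (Finsupp.single (MixVar.sigma 0) 1 + stateExponent MixVar.theta v) +
    (U v - x v) • (Finsupp.single (MixVar.sigma 1) 1 + stateExponent MixVar.rho v))

theorem mixtureCoordinate_pow (v : State s t) (n : ℕ) :
    (mixtureCoordinate v) ^ n = ∑ j ∈ Finset.range (n + 1), MvPolynomial.monomial
      (j • (Finsupp.single (MixVar.sigma 0) 1 + stateExponent MixVar.theta v) +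
        (n - j) • (Finsupp.single (MixVar.sigma 1) 1 + stateExponent MixVar.rho v))
      (n.choose j : ℚ) := by
  rw [mixtureCoordinate, add_pow]
  refine Finset.sum_congr rfl fun j _ => ?_
  rw [stateMonomial_eq_monomial, stateMonomial_eq_monomial, MvPolynomial.X, MvPolynomial.X,
    MvPolynomial.monomial_mul, MvPolynomial.monomial_mul, MvPolynomial.monomial_pow,
    MvPolynomial.monomial_pow, MvPolynomial.monomial_mul, ← map_natCast MvPolynomial.C, mul_comm,
    MvPolynomial.C_mul_monomial]
  simp

theorem prod_monomial {ι σ : Type*} (s : Finset ι) (e : ι → σ →₀ ℕ) (c : ι → ℚ) :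
    ∏ i ∈ s, MvPolynomial.monomial (e i) (c i) =
      MvPolynomial.monomial (∑ i ∈ s, e i) (∏ i ∈ s, c i) := by
  classical
  induction s using Finset.induction_on with
  | empty => simp
  | insert i s hi ih => simp [hi, ih, MvPolynomial.monomial_mul]

theorem mixtureLikelihood_eq (U : State s t → ℕ) :
    mixtureLikelihood U = ∑ x ∈ Fintype.piFinset fun v => Finset.range (U v + 1),
      MvPolynomial.monomial (mixtureExponent U x)
        (((∑ v, U v).factorial : ℚ) / (∏ v, ((U v).factorial : ℚ)) *
          ∏ v, ((U v).choose (x v) : ℚ)) := by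
  unfold mixtureLikelihood
  simp only [mixtureCoordinate_pow]
  rw [Finset.prod_univ_sum, Finset.mul_sum]
  refine Finset.sum_congr rfl fun x _ => ?_
  rw [prod_monomial, MvPolynomial.C_mul_monomial]
  rfl

theorem mixtureExponent_sigma_zero (U x : State s t → ℕ) :
    mixtureExponent U x (MixVar.sigma 0) = ∑ v, x v := by
  simp [mixtureExponent, stateExponent, Finsupp.finsetSum_apply]

theorem mixtureExponent_sigma_one (U x : State s t → ℕ) :
    mixtureExponent U x (MixVar.sigma 1) = ∑ v, (U v - x v) := by
  simp [mixtureExponent, stateExponent, Finsupp.finsetSum_apply]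

theorem mixtureExponent_theta (U x : State s t → ℕ) (p : Param t) :
    mixtureExponent U x (MixVar.theta p) = ∑ v, x v * (modelMatrix s t p v).toNat := by
  classical
  simp [mixtureExponent, stateExponent, Finsupp.finsetSum_apply, Finsupp.single_apply]

theorem mixtureExponent_rho (U x : State s t → ℕ) (p : Param t) :
    mixtureExponent U x (MixVar.rho p) = ∑ v, (U v - x v) * (modelMatrix s t p v).toNat := by
  classical
  simp [mixtureExponent, stateExponent, Finsupp.finsetSum_apply, Finsupp.single_apply]

theorem sum_modelMatrix (i : Fin k) (v : State s t) :
    ∑ c, (modelMatrix s t ⟨i, c⟩ v).toNat = s i := by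
  simp only [modelMatrix, Int.toNat_natCast]
  refine (Finset.card_eq_sum_card_fiberwise (f := v i) (s := Finset.univ) (t := Finset.univ)
    fun _ _ => Finset.mem_coe.mpr (Finset.mem_univ _)).symm.trans ?_
  simp

theorem modelMatrix_mulVec_apply (x : State s t → ℕ) (p : Param t) :
    (modelMatrix s t).mulVec (fun v => (x v : ℤ)) p =
      ((∑ v, x v * (modelMatrix s t p v).toNat : ℕ) : ℤ) := by
  simp [Matrix.mulVec, dotProduct, modelMatrix, mul_comm]

/-- The `theta` exponents are the entries of `A x`; the `rho` and `sigma 1` exponents are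
complements of the `theta` and `sigma 0` ones with respect to `U`. The `sigma 0` exponent `∑ v, x v`
is recovered from one block of rows of `A x`. -/
theorem mixtureExponent_eq_iff (hk : 0 < k) (hs : ∀ i, 0 < s i) {U x y : State s t → ℕ}
    (hx : x ≤ U) (hy : y ≤ U) :
    mixtureExponent U x = mixtureExponent U y ↔
      (modelMatrix s t).mulVec (fun v => (x v : ℤ)) =
        (modelMatrix s t).mulVec (fun v => (y v : ℤ)) := by
  have hcompl : ∀ (w : State s t → ℕ) (z : State s t → ℕ), z ≤ U →
      ∑ v, (U v - z v) * w v + ∑ v, z v * w v = ∑ v, U v * w v := by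
    intro w z hz
    rw [← Finset.sum_add_distrib]
    refine Finset.sum_congr rfl fun v _ => ?_
    rw [← add_mul, Nat.sub_add_cancel (hz v)]
  constructor
  · intro h
    funext p
    rw [modelMatrix_mulVec_apply, modelMatrix_mulVec_apply, ← mixtureExponent_theta U,
      ← mixtureExponent_theta U, h]
  · intro h
    have hp : ∀ p, ∑ v, x v * (modelMatrix s t p v).toNat =
        ∑ v, y v * (modelMatrix s t p v).toNat := by
      intro p
      have := congrFun h p
      rw [modelMatrix_mulVec_apply, modelMatrix_mulVec_apply] at this
      exact_mod_cast this
    -- In the rows of the first group, every column has entry sum `s ⟨0, hk⟩`, which is positive and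
    -- so can be cancelled.
    have hrow : ∀ z : State s t → ℕ, ∑ c, ∑ v, z v * (modelMatrix s t ⟨⟨0, hk⟩, c⟩ v).toNat =
        (∑ v, z v) * s ⟨0, hk⟩ := by
      intro z
      rw [Finset.sum_comm, Finset.sum_mul]
      simp only [← Finset.mul_sum, sum_modelMatrix]
    have hsum : ∑ v, x v = ∑ v, y v := by
      refine Nat.eq_of_mul_eq_mul_right (hs ⟨0, hk⟩) ?_
      rw [← hrow, ← hrow]
      exact Finset.sum_congr rfl fun c _ => hp _
    ext q
    rcases q with e | p | p
    · obtain rfl | rfl : e = 0 ∨ e = 1 := by lia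
      · rw [mixtureExponent_sigma_zero, mixtureExponent_sigma_zero, hsum]
      · rw [mixtureExponent_sigma_one, mixtureExponent_sigma_one]
        have h1 := hcompl 1 x hx
        have h2 := hcompl 1 y hy
        simp only [Pi.one_apply, mul_one] at h1 h2
        lia
    · rw [mixtureExponent_theta, mixtureExponent_theta, hp]
    · rw [mixtureExponent_rho, mixtureExponent_rho]
      have h1 := hcompl (fun v => (modelMatrix s t p v).toNat) x hx
      have h2 := hcompl (fun v => (modelMatrix s t p v).toNat) y hy
      have h3 := hp p
      lia

theorem card_support_mixtureLikelihood (hk : 0 < k) (hs : ∀ i, 0 < s i) (U : State s t → ℕ) :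
    (mixtureLikelihood U).support.card = (monomialSet (modelMatrix s t) U).ncard := by
  classical
  have hbox : ∀ x, x ∈ (Fintype.piFinset fun v => Finset.range (U v + 1)) ↔ x ≤ U := by
    intro x
    simp [Fintype.mem_piFinset, Pi.le_def]
  have hM : monomialSet (modelMatrix s t) U =
      ((Fintype.piFinset fun v => Finset.range (U v + 1)).image
        fun x => (modelMatrix s t).mulVec fun v => (x v : ℤ) : Finset (Param t → ℤ)) := by
    rw [monomialSet_eq]
    ext b
    simp only [boxSums, Finset.coe_image, Set.mem_image, Finset.mem_coe, hbox,
      mulVec_eq_sum_smul_col]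
    rfl
  rw [mixtureLikelihood_eq, support_sum_monomial_of_pos, hM, Set.ncard_coe_finset]
  -- The exponent map and `x ↦ A x` have the same fibres on the box, so their images are
  -- equinumerous.
  · refine le_antisymm (card_image_le_card_image fun x hx y hy h => ?_)
      (card_image_le_card_image fun x hx y hy h => ?_)
    · exact (mixtureExponent_eq_iff hk hs ((hbox x).mp hx) ((hbox y).mp hy)).mpr h
    · exact (mixtureExponent_eq_iff hk hs ((hbox x).mp hx) ((hbox y).mp hy)).mp h
  · intro x hx
    have hpos : 0 < ∏ v, ((U v).choose (x v) : ℚ) := Finset.prod_pos fun v _ => by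
      exact_mod_cast Nat.choose_pos ((hbox x).mp hx v)
    have hfac : 0 < ∏ v, ((U v).factorial : ℚ) := Finset.prod_pos fun v _ => by
      exact_mod_cast Nat.factorial_pos (U v)
    have hfac' : 0 < ((∑ v, U v).factorial : ℚ) := by exact_mod_cast Nat.factorial_pos _
    positivity

end Model

end MixtureZonotope

theorem mainTheorem5 :
    -- the independence models and their mixtures
    (∀ (k : ℕ) (s t : Fin k → ℕ), 0 < k → (∀ i, 0 < s i) →
      ∀ U : MixtureZonotope.State s t → ℕ,
        (MixtureZonotope.monomialSet (MixtureZonotope.modelMatrix s t) U).Finite ∧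
        (MixtureZonotope.mixtureLikelihood U).support.card =
          (MixtureZonotope.monomialSet (MixtureZonotope.modelMatrix s t) U).ncard ∧
        ∑ S ∈ MixtureZonotope.indepSets (MixtureZonotope.modelMatrix s t), ∏ v ∈ S, U v ≤
          (MixtureZonotope.monomialSet (MixtureZonotope.modelMatrix s t) U).ncard ∧
        (MixtureZonotope.monomialSet (MixtureZonotope.modelMatrix s t) U).ncard ≤
          ∑ S ∈ MixtureZonotope.indepSets (MixtureZonotope.modelMatrix s t),
            MixtureZonotope.latticeIndex (MixtureZonotope.modelMatrix s t) S * ∏ v ∈ S, U v ∧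
        (MixtureZonotope.IsUnimodular (MixtureZonotope.modelMatrix s t) →
          ∑ S ∈ MixtureZonotope.indepSets (MixtureZonotope.modelMatrix s t), ∏ v ∈ S, U v =
            ∑ S ∈ MixtureZonotope.indepSets (MixtureZonotope.modelMatrix s t),
              MixtureZonotope.latticeIndex (MixtureZonotope.modelMatrix s t) S *
                ∏ v ∈ S, U v)) ∧
    -- the two bounds for the set `M_A(U)` of an arbitrary integer matrix
    (∀ (d n : ℕ) (A : Matrix (Fin d) (Fin n) ℤ) (U : Fin n → ℕ),
        (MixtureZonotope.monomialSet A U).Finite ∧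
        ∑ S ∈ MixtureZonotope.indepSets A, ∏ v ∈ S, U v ≤
          (MixtureZonotope.monomialSet A U).ncard ∧
        (MixtureZonotope.monomialSet A U).ncard ≤
          ∑ S ∈ MixtureZonotope.indepSets A,
            MixtureZonotope.latticeIndex A S * ∏ v ∈ S, U v ∧
        (MixtureZonotope.IsUnimodular A →
          ∑ S ∈ MixtureZonotope.indepSets A, ∏ v ∈ S, U v =
            ∑ S ∈ MixtureZonotope.indepSets A,
              MixtureZonotope.latticeIndex A S * ∏ v ∈ S, U v)) := by

  refine ⟨fun k s t hk hs U => ?_, fun d n A U => ?_⟩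
  · exact ⟨MixtureZonotope.finite_monomialSet _ U,
      MixtureZonotope.card_support_mixtureLikelihood hk hs U,
      MixtureZonotope.sum_indepSets_le_ncard_monomialSet _ U,
      MixtureZonotope.ncard_monomialSet_le_sum_latticeIndex _ U,
      fun hA => MixtureZonotope.sum_indepSets_eq_of_isUnimodular hA U⟩
  · exact ⟨MixtureZonotope.finite_monomialSet A U,
      MixtureZonotope.sum_indepSets_le_ncard_monomialSet A U,
      MixtureZonotope.ncard_monomialSet_le_sum_latticeIndex A U,
      fun hA => MixtureZonotope.sum_indepSets_eq_of_isUnimodular hA U⟩
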